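/- All graphs are finite, simple and undirected. For a graph $G$ let $R(G)=\sum_{uv\in E(G)}\frac{1}{\sqrt{\deg_G(u)\deg_G(v)}}$ be its Randić index, and let $m_{i,j}(G)$ be the number of edges of $G$ that join a vertex of degree $i$ to a vertex of degree $j$. A connected graph with $n$ vertices has cyclomatic number $k$ if it has $n+k-1$ edges. Let $G$ be a connected graph with $n$ vertices and cyclomatic number $k\ge 3$. 1. If $n\ge 2k-1$, then $R(G)\le \frac{n}{2}-\frac{5-2\sqrt6}{6}$, with equality if and only if $G\in\Lambda_k^1(n)$, that is, if and only if $m_{3,3}(G)=3k-4$, $m_{2,3}(G)=2$ and $m_{2,2}(G)=n-(2k-1)$. 2. If $n=2k-2$, then $R(G)\le \frac{n}{2}$, with equality if and only if $G$ is $3$-regular. -/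

import Mathlib

namespace RandicIndex

variable {V : Type*} [Fintype V] [DecidableEq V]

/-- The Randić index: the sum over the edges `uv` of `1 / √(deg u * deg v)`. -/
noncomputable def randic (G : SimpleGraph V) [DecidableRel G.Adj] : ℝ :=
  ∑ e ∈ G.edgeFinset,
    Sym2.lift ⟨fun u v => 1 / √((G.degree u : ℝ) * (G.degree v : ℝ)),
      fun u v => by simp only [mul_comm]⟩ e

/-- `m_{i,j}(G)`: the number of edges that join a vertex of degree `i` to a vertex of
degree `j`. -/
def edgeCount (G : SimpleGraph V) [DecidableRel G.Adj] (i j : ℕ) : ℕ :=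
  (G.edgeFinset.filter fun e => e.map (fun v => G.degree v) = s(i, j)).card

/-- The cyclomatic number of a connected graph: it is `c` when the graph has `n` vertices and
`n + c - 1` edges. -/
def cyclomaticNumber (G : SimpleGraph V) [DecidableRel G.Adj] : ℤ :=
  (G.edgeFinset.card : ℤ) - (Fintype.card V : ℤ) + 1

/-- Membership in the class `Λ_k^1(n)`. The equations are read in `ℤ`, so that no subtraction
is truncated. -/
def InLambda1 (k n : ℕ) (G : SimpleGraph V) [DecidableRel G.Adj] : Prop :=
  (edgeCount G 3 3 : ℤ) = 3 * (k : ℤ) - 4 ∧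
  (edgeCount G 2 3 : ℤ) = 2 ∧
  (edgeCount G 2 2 : ℤ) = (n : ℤ) - (2 * (k : ℤ) - 1)

end RandicIndex

/-!
For positive degrees `a` and `b`, `1 / √(ab) = (1 / a + 1 / b) / 2 - loss a b` with
`loss a b = (1 / √a - 1 / √b) ^ 2 / 2 ≥ 0`. Summed over the edges, the first term contributes
`1 / 2` for every vertex, so `R(G)` is `n / 2` minus the total loss. The loss vanishes only on edges
with equal end degrees, which settles the case of average degree three.

If `n ≥ 2k - 1`, the average degree lies strictly between two and three, so there are vertices of
degree at most two and of degree at least three. A leaf forces an edge of loss at least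
`loss 1 2 > 2 * loss 2 3`. Without leaves, an even number of edges leaves the set of vertices of
degree two, because the degrees in that set are even; hence at least two edges do, each of loss at
least `loss 2 3`, and a vertex of degree four or more makes the inequality strict.
-/

namespace RandicIndex

open Finset

section Loss

/-- The loss `(1 / √a - 1 / √b) ^ 2 / 2` of an edge with end degrees `a` and `b`: the amount by
which `1 / √(ab)` falls short of `(1 / a + 1 / b) / 2`. It is defined for real arguments so that
monotonicity can be stated without casts. -/
noncomputable def loss (a b : ℝ) : ℝ := ((√a)⁻¹ - (√b)⁻¹) ^ 2 / 2

theorem loss_comm (a b : ℝ) : loss a b = loss b a := by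
  unfold loss; ring

theorem loss_nonneg (a b : ℝ) : 0 ≤ loss a b := by
  unfold loss; positivity

theorem loss_eq_zero_iff {a b : ℝ} (ha : 0 ≤ a) (hb : 0 ≤ b) : loss a b = 0 ↔ a = b := by
  simp [loss, sub_eq_zero, Real.sqrt_inj ha hb]

@[simp]
theorem loss_self (a : ℝ) : loss a a = 0 := by
  simp [loss]

theorem loss_pos {a b : ℝ} (ha : 0 ≤ a) (hb : 0 ≤ b) (hab : a ≠ b) : 0 < loss a b :=
  (loss_nonneg a b).lt_of_ne' (mt (loss_eq_zero_iff ha hb).1 hab)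

theorem loss_lt_loss {a b c : ℝ} (ha : 0 < a) (hab : a ≤ b) (hbc : b < c) :
    loss a b < loss a c := by
  have hb : 0 < b := ha.trans_le hab
  have hba : (√b)⁻¹ ≤ (√a)⁻¹ := by gcongr
  have hcb : (√c)⁻¹ < (√b)⁻¹ := by gcongr
  unfold loss
  gcongr

theorem loss_le_loss {a b c : ℝ} (ha : 0 < a) (hab : a ≤ b) (hbc : b ≤ c) :
    loss a b ≤ loss a c := by
  rcases hbc.eq_or_lt with rfl | hbc
  · exact le_rfl
  · exact (loss_lt_loss ha hab hbc).le

theorem one_div_sqrt_mul_eq {a b : ℝ} (ha : 0 ≤ a) (hb : 0 ≤ b) :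
    1 / √(a * b) = (a⁻¹ + b⁻¹) / 2 - loss a b := by
  have hsq : ∀ {x : ℝ}, 0 ≤ x → x⁻¹ = (√x)⁻¹ ^ 2 := fun hx => by rw [inv_pow, Real.sq_sqrt hx]
  rw [loss, hsq ha, hsq hb, Real.sqrt_mul ha, one_div, mul_inv]
  ring

theorem two_mul_loss_two_three : 2 * loss 2 3 = (5 - 2 * √6) / 6 := by
  have h := one_div_sqrt_mul_eq (a := 2) (b := 3) (by norm_num) (by norm_num)
  rw [show (2 * 3 : ℝ) = 6 by norm_num, ← Real.sqrt_div_self'] at h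
  linarith

theorem two_mul_loss_two_three_lt_loss_one_two : 2 * loss 2 3 < loss 1 2 := by
  have h := one_div_sqrt_mul_eq (a := 1) (b := 2) (by norm_num) (by norm_num)
  rw [one_mul, ← Real.sqrt_div_self'] at h
  have h2 : √2 < 1.42 := (Real.sqrt_lt' (by norm_num)).2 (by norm_num)
  have h6 : 2.4 < √6 := Real.lt_sqrt_of_sq_lt (by norm_num)
  linarith [two_mul_loss_two_three]

end Loss

theorem exists_adj_mem_notMem {V : Type*} {G : SimpleGraph V} (hG : G.Preconnected) {S : Set V}
    {a b : V} (ha : a ∈ S) (hb : b ∉ S) : ∃ u v, G.Adj u v ∧ u ∈ S ∧ v ∉ S := by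
  obtain ⟨p⟩ := hG a b
  obtain ⟨d, -, hu, hv⟩ := p.exists_boundary_dart S ha hb
  exact ⟨d.fst, d.snd, d.adj, hu, hv⟩

variable {V : Type*} [Fintype V] {G : SimpleGraph V} [DecidableRel G.Adj]

section DoubleCounting

theorem sum_toFinset_mk {α M : Type*} [DecidableEq α] [AddCommMonoid M] {a b : α} (hab : a ≠ b)
    (f : α → M) : ∑ x ∈ s(a, b).toFinset, f x = f a + f b := by
  rw [Sym2.toFinset_mk_eq, sum_pair hab]

theorem sum_edgeFinset_sum_toFinset [DecidableEq V] {M : Type*} [AddCommMonoid M] (f : V → M) :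
    ∑ e ∈ G.edgeFinset, ∑ v ∈ e.toFinset, f v = ∑ v, G.degree v • f v := by
  simp_rw [← G.card_incidenceFinset_eq_degree, ← sum_const]
  exact sum_comm' fun e v => by simp [G.incidenceFinset_eq_filter]

theorem exists_lt_degree {d : ℕ} (h : d * Fintype.card V < 2 * #G.edgeFinset) :
    ∃ v, d < G.degree v := by
  rw [← G.sum_degrees_eq_twice_card_edges] at h
  simpa using exists_lt_of_sum_lt (s := univ) (f := fun _ => d) (by simpa [mul_comm] using h)

theorem exists_degree_lt {d : ℕ} (h : 2 * #G.edgeFinset < d * Fintype.card V) :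
    ∃ v, G.degree v < d := by
  rw [← G.sum_degrees_eq_twice_card_edges] at h
  simpa using exists_lt_of_sum_lt (s := univ) (g := fun _ => d) (by simpa [mul_comm] using h)

end DoubleCounting

section EdgeBoundary

variable [DecidableEq V]

/-- The edge boundary of a set `S` of vertices: the edges with one end in `S` and one end outside
`S`. -/
def edgeBoundary (G : SimpleGraph V) [DecidableRel G.Adj] (S : Finset V) : Finset (Sym2 V) :=
  {e ∈ G.edgeFinset | (∃ v ∈ e, v ∈ S) ∧ ∃ v ∈ e, v ∉ S}

theorem mk_mem_edgeBoundary {S : Finset V} {u v : V} :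
    s(u, v) ∈ edgeBoundary G S ↔ G.Adj u v ∧ (u ∈ S ∧ v ∉ S ∨ v ∈ S ∧ u ∉ S) := by
  simp only [edgeBoundary, mem_filter, SimpleGraph.mem_edgeFinset, SimpleGraph.mem_edgeSet,
    Sym2.mem_iff, exists_eq_or_imp, exists_eq_left]
  tauto

theorem even_card_edgeBoundary_iff (S : Finset V) :
    Even #(edgeBoundary G S) ↔ Even (∑ v ∈ S, G.degree v) := by
  have hcount := sum_edgeFinset_sum_toFinset (G := G) fun v => if v ∈ S then 1 else 0
  have hfilter : edgeBoundary G S =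
      {e ∈ G.edgeFinset | Odd (∑ v ∈ e.toFinset, if v ∈ S then 1 else 0)} := by
    ext e
    induction e with | _ u v =>
    by_cases huv : G.Adj u v
    · simp only [mk_mem_edgeBoundary, mem_filter, sum_toFinset_mk huv.ne]
      by_cases hu : u ∈ S <;> by_cases hv : v ∈ S <;> simp [huv, hu, hv]
    · simp [mk_mem_edgeBoundary, huv]
  rw [hfilter, ← even_sum_iff_even_card_odd, hcount]
  simp

theorem two_le_card_edgeBoundary (hG : G.Preconnected) {S : Finset V}
    (hS : ∀ v ∈ S, Even (G.degree v)) {a b : V} (ha : a ∈ S) (hb : b ∉ S) :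
    2 ≤ #(edgeBoundary G S) := by
  obtain ⟨u, v, huv, hu, hv⟩ := exists_adj_mem_notMem hG (S := S) ha hb
  have hpos : 0 < #(edgeBoundary G S) :=
    card_pos.2 ⟨s(u, v), mk_mem_edgeBoundary.2 ⟨huv, .inl ⟨hu, hv⟩⟩⟩
  obtain ⟨r, hr⟩ := (even_card_edgeBoundary_iff S).2 (even_sum _ hS)
  lia

end EdgeBoundary

section EdgeCount

theorem edgeCount_comm (i j : ℕ) : edgeCount G i j = edgeCount G j i := by
  simp only [edgeCount, Sym2.eq_swap (a := i)]

theorem edgeCount_add_edgeCount_add_edgeCount [DecidableEq V] {i j : ℕ} (hij : i ≠ j) :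
    edgeCount G i i + edgeCount G i j + edgeCount G j j =
      #{e ∈ G.edgeFinset | ∀ v ∈ e, G.degree v = i ∨ G.degree v = j} := by
  simp only [edgeCount, card_filter, ← sum_add_distrib]
  refine sum_congr rfl fun e _ => ?_
  induction e with | _ u v =>
  simp only [Sym2.map_mk, Sym2.eq_iff, Sym2.mem_iff, forall_eq_or_imp, forall_eq]
  split_ifs <;> lia

theorem edgeCount_add_edgeCount_add_edgeCount_eq_card_iff {i j : ℕ} (hij : i ≠ j)
    (hpos : ∀ v, 0 < G.degree v) :
    edgeCount G i i + edgeCount G i j + edgeCount G j j = #G.edgeFinset ↔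
      ∀ v, G.degree v = i ∨ G.degree v = j := by
  classical
  rw [edgeCount_add_edgeCount_add_edgeCount hij, card_filter_eq_iff]
  refine ⟨fun h v => ?_, fun h _ _ v _ => h v⟩
  obtain ⟨w, hw⟩ := (G.degree_pos_iff_exists_adj v).1 (hpos v)
  exact h s(v, w) (by simpa using hw) v (Sym2.mem_mk_left v w)

theorem two_mul_edgeCount_add_edgeCount {i j : ℕ} (hij : i ≠ j)
    (hdeg : ∀ v, G.degree v = i ∨ G.degree v = j) :
    2 * edgeCount G i i + edgeCount G i j = i * #{v | G.degree v = i} := by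
  classical
  have hcount := sum_edgeFinset_sum_toFinset (G := G) fun v => if G.degree v = i then 1 else 0
  have hdegree : ∑ v, G.degree v • (if G.degree v = i then 1 else 0) =
      i * #{v | G.degree v = i} := by
    rw [card_filter, mul_sum]
    exact sum_congr rfl fun v _ => by split_ifs with hv <;> simp [hv]
  rw [← hdegree, ← hcount]
  simp only [edgeCount, card_filter, mul_sum, ← sum_add_distrib]
  refine sum_congr rfl fun e he => ?_
  induction e with | _ u v =>
  have huv : u ≠ v := (show G.Adj u v by simpa using he).ne
  rw [sum_toFinset_mk huv]
  rcases hdeg u with hu | hu <;> rcases hdeg v with hv | hv <;> simp [hu, hv, hij, hij.symm]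

theorem inLambda1_iff {k : ℕ} (hpos : ∀ v, 0 < G.degree v) (hcyc : cyclomaticNumber G = k) :
    InLambda1 k (Fintype.card V) G ↔
      (∀ v, G.degree v = 2 ∨ G.degree v = 3) ∧ edgeCount G 2 3 = 2 := by
  unfold cyclomaticNumber at hcyc
  have htotal := edgeCount_add_edgeCount_add_edgeCount_eq_card_iff (i := 2) (j := 3) (by simp) hpos
  refine ⟨fun ⟨h33, h23, h22⟩ => ⟨htotal.1 (by lia), by lia⟩, fun ⟨hdeg, h23⟩ => ?_⟩
  have hcard : #{v | G.degree v = 2} + #{v | G.degree v = 3} = Fintype.card V := by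
    simp_rw [show ∀ v, G.degree v = 3 ↔ ¬G.degree v = 2 by grind]
    exact card_filter_add_card_filter_not _
  have htwo := two_mul_edgeCount_add_edgeCount (by simp) hdeg
  have hthree := two_mul_edgeCount_add_edgeCount (by simp) fun v => (hdeg v).symm
  rw [edgeCount_comm 3 2] at hthree
  have := htotal.2 hdeg
  exact ⟨by lia, mod_cast h23, by lia⟩

end EdgeCount

section TotalLoss

/-- The loss of an edge in terms of the degrees of its ends, as a function on unordered pairs of
vertices. -/
noncomputable def edgeLoss (G : SimpleGraph V) [DecidableRel G.Adj] : Sym2 V → ℝ :=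
  Sym2.lift ⟨fun u v => loss (G.degree u) (G.degree v), fun _ _ => loss_comm _ _⟩

/-- The sum of the losses of the edges, which is the amount by which the Randić index of a graph
without isolated vertices falls short of half the number of vertices. -/
noncomputable def totalLoss (G : SimpleGraph V) [DecidableRel G.Adj] : ℝ :=
  ∑ e ∈ G.edgeFinset, edgeLoss G e

theorem edgeLoss_mk (u v : V) : edgeLoss G s(u, v) = loss (G.degree u) (G.degree v) := rfl

theorem edgeLoss_nonneg (e : Sym2 V) : 0 ≤ edgeLoss G e := by
  induction e with | _ u v => exact loss_nonneg _ _

theorem totalLoss_nonneg : 0 ≤ totalLoss G :=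
  sum_nonneg fun e _ => edgeLoss_nonneg e

theorem loss_le_totalLoss {u v : V} (huv : G.Adj u v) :
    loss (G.degree u) (G.degree v) ≤ totalLoss G :=
  single_le_sum (f := edgeLoss G) (fun e _ => edgeLoss_nonneg e)
    (show s(u, v) ∈ G.edgeFinset by simpa using huv)

theorem randic_eq (hpos : ∀ v, 0 < G.degree v) :
    randic G = Fintype.card V / 2 - totalLoss G := by
  classical
  have hhalf : ∑ e ∈ G.edgeFinset, ∑ v ∈ e.toFinset, (G.degree v : ℝ)⁻¹ / 2 =
      Fintype.card V / 2 := by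
    have hvertex (v : V) : G.degree v • ((G.degree v : ℝ)⁻¹ / 2) = 1 / 2 := by
      have : (G.degree v : ℝ) ≠ 0 := by exact_mod_cast (hpos v).ne'
      rw [nsmul_eq_mul]
      field_simp
    rw [sum_edgeFinset_sum_toFinset, sum_congr rfl fun v _ => hvertex v]
    simp [div_eq_mul_inv]
  rw [← hhalf, totalLoss, ← sum_sub_distrib]
  refine sum_congr rfl fun e he => ?_
  induction e with | _ u v =>
  have huv : u ≠ v := (show G.Adj u v by simpa using he).ne
  rw [Sym2.lift_mk, edgeLoss_mk, sum_toFinset_mk huv, ← add_div]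
  exact one_div_sqrt_mul_eq (Nat.cast_nonneg _) (Nat.cast_nonneg _)

theorem totalLoss_eq_edgeCount_mul_loss {i j : ℕ} (hdeg : ∀ v, G.degree v = i ∨ G.degree v = j) :
    totalLoss G = edgeCount G i j * loss i j := by
  rw [totalLoss, edgeCount, ← nsmul_eq_mul, ← sum_const, sum_filter]
  refine sum_congr rfl fun e _ => ?_
  induction e with | _ u v =>
  rw [edgeLoss_mk]
  rcases hdeg u with hu | hu <;> rcases hdeg v with hv | hv <;>
    simp +contextual [hu, hv, loss_comm j i]

theorem totalLoss_eq_zero_iff (hG : G.Preconnected) {d : ℕ}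
    (hcard : 2 * #G.edgeFinset = d * Fintype.card V) :
    totalLoss G = 0 ↔ G.IsRegularOfDegree d := by
  refine ⟨fun h v => ?_, fun h => ?_⟩
  · have hconst (w : V) : G.degree w = G.degree v := by
      by_contra hw
      obtain ⟨x, y, hxy, hx, hy⟩ :=
        exists_adj_mem_notMem hG (S := {x | G.degree x = G.degree v}) rfl hw
      have hle := h ▸ loss_le_totalLoss hxy
      have hne : (G.degree x : ℝ) ≠ G.degree y :=
        Nat.cast_injective.ne fun hdeg => hy (hdeg.symm.trans hx)
      exact hle.not_gt (loss_pos (Nat.cast_nonneg _) (Nat.cast_nonneg _) hne)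
    have hsum := G.sum_degrees_eq_twice_card_edges
    simp only [hconst, sum_const, card_univ, smul_eq_mul, hcard, mul_comm d] at hsum
    exact Nat.eq_of_mul_eq_mul_left (Fintype.card_pos_iff.2 ⟨v⟩) hsum
  · simpa using totalLoss_eq_edgeCount_mul_loss (j := d) fun v => .inl (h v)

end TotalLoss

section LowerBound

theorem two_mul_loss_two_three_lt_totalLoss_of_degree_le_one (hG : G.Preconnected) {a b : V}
    (ha : G.degree a ≤ 1) (hb : 2 ≤ G.degree b) : 2 * loss 2 3 < totalLoss G := by
  obtain ⟨u, v, huv, hu : G.degree u ≤ 1, hv : ¬G.degree v ≤ 1⟩ :=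
    exists_adj_mem_notMem hG (S := {x | G.degree x ≤ 1}) ha (b := b)
      (show ¬G.degree b ≤ 1 from not_le.2 hb)
  have hu1 : G.degree u = 1 := le_antisymm hu huv.degree_pos_left
  have hv2 : (2 : ℝ) ≤ G.degree v := by exact_mod_cast not_le.1 hv
  calc 2 * loss 2 3 < loss 1 2 := two_mul_loss_two_three_lt_loss_one_two
    _ ≤ loss 1 (G.degree v) := loss_le_loss one_pos one_le_two hv2
    _ = loss (G.degree u) (G.degree v) := by rw [hu1, Nat.cast_one]
    _ ≤ totalLoss G := loss_le_totalLoss huv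

section MinDegree

variable [DecidableEq V] {d : ℕ}

theorem loss_le_edgeLoss_of_mem_edgeBoundary (hd : 0 < d) (hmin : ∀ v, d ≤ G.degree v)
    {e : Sym2 V} (he : e ∈ edgeBoundary G {v | G.degree v = d}) :
    loss d (d + 1 : ℕ) ≤ edgeLoss G e := by
  have hmono {v : V} (hv : G.degree v ≠ d) : loss d (d + 1 : ℕ) ≤ loss d (G.degree v) := by
    have hlt : d + 1 ≤ G.degree v := (hmin v).lt_of_ne' hv
    exact loss_le_loss (Nat.cast_pos.2 hd) (Nat.cast_le.2 d.le_succ) (Nat.cast_le.2 hlt)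
  induction e with | _ u v =>
  simp only [mk_mem_edgeBoundary, mem_filter, mem_univ, true_and] at he
  rw [edgeLoss_mk]
  obtain ⟨-, ⟨hu, hv⟩ | ⟨hv, hu⟩⟩ := he
  · rw [hu]
    exact hmono hv
  · rw [hv, loss_comm _ (d : ℝ)]
    exact hmono hu

theorem card_edgeBoundary_mul_loss_le_sum (hd : 0 < d) (hmin : ∀ v, d ≤ G.degree v) :
    #(edgeBoundary G {v | G.degree v = d}) * loss d (d + 1 : ℕ) ≤
      ∑ e ∈ edgeBoundary G {v | G.degree v = d}, edgeLoss G e := by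
  rw [← nsmul_eq_mul]
  exact card_nsmul_le_sum _ _ _ fun e he => loss_le_edgeLoss_of_mem_edgeBoundary hd hmin he

theorem sum_edgeBoundary_le_totalLoss (S : Finset V) :
    ∑ e ∈ edgeBoundary G S, edgeLoss G e ≤ totalLoss G :=
  sum_le_sum_of_subset_of_nonneg (filter_subset _ _) fun e _ _ => edgeLoss_nonneg e

theorem card_edgeBoundary_mul_loss_lt_totalLoss (hG : G.Preconnected) (hd : 0 < d)
    (hmin : ∀ v, d ≤ G.degree v) {a c : V} (ha : G.degree a = d) (hc : d + 1 < G.degree c) :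
    #(edgeBoundary G {v | G.degree v = d}) * loss d (d + 1 : ℕ) < totalLoss G := by
  obtain ⟨u, v, huv, hu : G.degree u ≤ d + 1, hv : ¬G.degree v ≤ d + 1⟩ :=
    exists_adj_mem_notMem hG (S := {x | G.degree x ≤ d + 1}) (a := a) (b := c) (by simp [ha])
      (by simpa using hc)
  rw [not_le] at hv
  by_cases hB : s(u, v) ∈ edgeBoundary G {v | G.degree v = d}
  · have hud : G.degree u = d := by
      simp only [mk_mem_edgeBoundary, mem_filter, mem_univ, true_and] at hB
      lia
    have hlt : loss d (d + 1 : ℕ) < edgeLoss G s(u, v) := by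
      rw [edgeLoss_mk, hud]
      exact loss_lt_loss (Nat.cast_pos.2 hd) (Nat.cast_le.2 d.le_succ) (Nat.cast_lt.2 hv)
    refine lt_of_lt_of_le ?_ (sum_edgeBoundary_le_totalLoss {v | G.degree v = d})
    rw [← nsmul_eq_mul, ← sum_const]
    exact sum_lt_sum (fun e he => loss_le_edgeLoss_of_mem_edgeBoundary hd hmin he) ⟨_, hB, hlt⟩
  · refine (card_edgeBoundary_mul_loss_le_sum hd hmin).trans_lt ?_
    have hpos : 0 < edgeLoss G s(u, v) :=
      loss_pos (Nat.cast_nonneg _) (Nat.cast_nonneg _) (Nat.cast_injective.ne (by lia))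
    exact sum_lt_sum_of_subset (filter_subset _ _) (by simpa using huv) hB hpos
      fun e _ _ => edgeLoss_nonneg e

theorem two_mul_loss_two_three_le_card_edgeBoundary_mul (hG : G.Preconnected) {a b : V}
    (ha : G.degree a = 2) (hb : G.degree b ≠ 2) :
    2 * loss 2 3 ≤ #(edgeBoundary G {v | G.degree v = 2}) * loss 2 3 := by
  have htwo := two_le_card_edgeBoundary hG (S := {v | G.degree v = 2}) (a := a) (b := b)
    (by simp +contextual) (by simpa using ha) (by simpa using hb)
  exact mul_le_mul_of_nonneg_right (by exact_mod_cast htwo) (loss_nonneg 2 3)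

end MinDegree

theorem two_mul_loss_two_three_le_totalLoss (hG : G.Preconnected) {a b : V}
    (ha : G.degree a ≤ 2) (hb : 3 ≤ G.degree b) : 2 * loss 2 3 ≤ totalLoss G := by
  classical
  by_cases! hmin : ∀ v, 2 ≤ G.degree v
  · calc 2 * loss 2 3
      _ ≤ #(edgeBoundary G {v | G.degree v = 2}) * loss 2 3 :=
        two_mul_loss_two_three_le_card_edgeBoundary_mul hG (ha.antisymm (hmin a)) (b := b) (by lia)
      _ ≤ _ := mod_cast card_edgeBoundary_mul_loss_le_sum two_pos hmin
      _ ≤ totalLoss G := sum_edgeBoundary_le_totalLoss _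
  · obtain ⟨c, hc⟩ := hmin
    exact (two_mul_loss_two_three_lt_totalLoss_of_degree_le_one hG (a := c) (b := b)
      (by lia) (by lia)).le

theorem two_mul_loss_two_three_lt_totalLoss (hG : G.Preconnected) {a b c : V}
    (ha : G.degree a ≤ 2) (hb : 3 ≤ G.degree b) (hc : ¬(G.degree c = 2 ∨ G.degree c = 3)) :
    2 * loss 2 3 < totalLoss G := by
  classical
  by_cases! hmin : ∀ v, 2 ≤ G.degree v
  · have ha2 : G.degree a = 2 := ha.antisymm (hmin a)
    have hc4 : 3 < G.degree c := by
      have := hmin c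
      lia
    calc 2 * loss 2 3
      _ ≤ #(edgeBoundary G {v | G.degree v = 2}) * loss 2 3 :=
        two_mul_loss_two_three_le_card_edgeBoundary_mul hG ha2 (b := b) (by lia)
      _ < totalLoss G :=
        mod_cast card_edgeBoundary_mul_loss_lt_totalLoss hG two_pos hmin ha2 hc4
  · obtain ⟨x, hx⟩ := hmin
    exact two_mul_loss_two_three_lt_totalLoss_of_degree_le_one hG (a := x) (b := b)
      (by lia) (by lia)

theorem totalLoss_eq_two_mul_loss_two_three_iff (hG : G.Preconnected) {a b : V}
    (ha : G.degree a ≤ 2) (hb : 3 ≤ G.degree b) :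
    totalLoss G = 2 * loss 2 3 ↔
      (∀ v, G.degree v = 2 ∨ G.degree v = 3) ∧ edgeCount G 2 3 = 2 := by
  have hmul (hdeg : ∀ v, G.degree v = 2 ∨ G.degree v = 3) :
      totalLoss G = edgeCount G 2 3 * loss 2 3 := mod_cast totalLoss_eq_edgeCount_mul_loss hdeg
  refine ⟨fun h => ?_, fun ⟨hdeg, h23⟩ => by rw [hmul hdeg, h23, Nat.cast_ofNat]⟩
  have hdeg (v : V) : G.degree v = 2 ∨ G.degree v = 3 := by
    by_contra hv
    exact (two_mul_loss_two_three_lt_totalLoss hG ha hb hv).ne' h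
  have hloss : loss 2 3 ≠ 0 := (loss_pos (by simp) (by simp) (by norm_num)).ne'
  have h23 : (edgeCount G 2 3 : ℝ) = 2 :=
    mul_right_cancel₀ hloss ((hmul hdeg).symm.trans h)
  exact ⟨hdeg, mod_cast h23⟩

end LowerBound

end RandicIndex

open RandicIndex in
theorem mainTheorem1_general {V : Type*} [Fintype V] (G : SimpleGraph V) [DecidableRel G.Adj]
    (n k : ℕ) (hn : Fintype.card V = n) (hconn : G.Connected) (hk : 2 ≤ k)
    (hcyc : cyclomaticNumber G = k) :
    (2 * (k : ℤ) - 1 ≤ n →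
      randic G ≤ n / 2 - (5 - 2 * √6) / 6 ∧
      (randic G = n / 2 - (5 - 2 * √6) / 6 ↔ InLambda1 k n G)) ∧
    ((n : ℤ) = 2 * k - 2 →
      randic G ≤ n / 2 ∧ (randic G = n / 2 ↔ G.IsRegularOfDegree 3)) := by
  classical
  subst hn
  have hcard : (G.edgeFinset.card : ℤ) - Fintype.card V + 1 = k := hcyc
  have hpos (h : 2 * (k : ℤ) - 2 ≤ Fintype.card V) (v : V) : 0 < G.degree v := by
    have := Fintype.one_lt_card_iff_nontrivial.1 (show 1 < Fintype.card V by lia)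
    exact hconn.preconnected.degree_pos_of_nontrivial v
  refine ⟨fun h => ?_, fun h => ?_⟩
  · obtain ⟨a, ha⟩ : ∃ a, G.degree a < 3 := exists_degree_lt (by lia)
    obtain ⟨b, hb⟩ : ∃ b, 2 < G.degree b := exists_lt_degree (by lia)
    have ha : G.degree a ≤ 2 := Nat.le_of_lt_succ ha
    rw [randic_eq (hpos (by lia)), inLambda1_iff (hpos (by lia)) hcyc, ← two_mul_loss_two_three,
      sub_right_inj, totalLoss_eq_two_mul_loss_two_three_iff hconn.preconnected ha hb]
    exact ⟨sub_le_sub_left (two_mul_loss_two_three_le_totalLoss hconn.preconnected ha hb) _,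
      Iff.rfl⟩
  · rw [randic_eq (hpos h.ge), sub_eq_self,
      totalLoss_eq_zero_iff hconn.preconnected (d := 3) (by lia)]
    exact ⟨sub_le_self _ totalLoss_nonneg, Iff.rfl⟩

theorem mainTheorem1 {V : Type*} [Fintype V] [DecidableEq V]
    (G : SimpleGraph V) [DecidableRel G.Adj] (n k : ℕ)
    (hn : Fintype.card V = n) (hconn : G.Connected)
    (hk : 3 ≤ k) (hcyc : RandicIndex.cyclomaticNumber G = (k : ℤ)) :
    ((2 * (k : ℤ) - 1 ≤ (n : ℤ)) →
      RandicIndex.randic G ≤ (n : ℝ) / 2 - (5 - 2 * √(6 : ℝ)) / 6 ∧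
      (RandicIndex.randic G = (n : ℝ) / 2 - (5 - 2 * √(6 : ℝ)) / 6 ↔
        RandicIndex.InLambda1 k n G)) ∧
    (((n : ℤ) = 2 * (k : ℤ) - 2) →
      RandicIndex.randic G ≤ (n : ℝ) / 2 ∧
      (RandicIndex.randic G = (n : ℝ) / 2 ↔ G.IsRegularOfDegree 3)) :=
  mainTheorem1_general G n k hn hconn (by lia) hcyc
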